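/- **Conventions.** Let $d\ge 1$ and $\Omega_d=[0,1)^d$. For $u>0$ let $h^1_u$ be the characteristic function of $[-u/2,u/2)$ on $\mathbb R$, and for $r\ge 2$ let $h^r_u=h^{r-1}_u*h^1_u$ (convolution on $\mathbb R$). For $r\in\mathbb N$ and a box $B=\prod_{j=1}^d[c_j-ru_j/2,\,c_j+ru_j/2)$ with all $u_j>0$ put $h^r_B(\mathbf x)=\prod_{j=1}^d h^r_{u_j}(x_j-c_j)$, and let $\tilde h^r_B(\mathbf x)=\sum_{\mathbf n\in\mathbb Z^d}h^r_B(\mathbf n+\mathbf x)$ be its periodization. For points $\xi=(\xi^\mu)_{\mu=1}^m$ in $\Omega_d$ and $v\in(0,1]$ the periodic $r$-smooth fixed volume $L_\infty$-discrepancy is $$\tilde D^r_\infty(\xi,v)=\sup_{B\subset\Omega_d,\ \mathrm{vol}(B)=v}\ \operatorname*{ess\,sup}_{\mathbf z\in\Omega_d}\left|\int_{\Omega_d}\tilde h^r_B(\mathbf x-\mathbf z)\,d\mathbf x-\frac1m\sum_{\mu=1}^m\tilde h^r_B(\xi^\mu-\mathbf z)\right| .$$ For $m\in\mathbb N$, $m\ge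 1$, and $\mathbf a\in\mathbb Z^d$, the Korobov points are $\mathbf y^\mu=(\{\mu a_1/m\},\dots,\{\mu a_d/m\})$, $\mu=1,\dots,m$ (counted with multiplicity; $\{\cdot\}$ is the fractional part); $\mathcal K_m(\mathbf a)=(\mathbf y^\mu)_{\mu=1}^m$ and $P_m(f,\mathbf a)=\frac1m\sum_{\mu=1}^m f(\mathbf y^\mu)$. For $N\in\mathbb N$ let $\mathcal T(N,d)$ be the complex linear span of the functions $e^{2\pi i(\mathbf k,\mathbf x)}$ with $\mathbf k\in\mathbb Z^d$ and $\prod_{j=1}^d\max(|k_j|,1)\le N$. The formula $P_m(\cdot,\mathbf a)$ is exact on $\mathcal T(N,d)$ if $P_m(f,\mathbf a)=\int_{\Omega_d}f(\mathbf x)\,d\mathbf x$ for all $f\in\mathcal T(N,d)$. **Theorem.** For every integer $d\ge 1$ there are constants $c(d),C(d)>0$, depending only on $d$, such that the following holds. Let $r,L,m\in\mathbb N$ with $r\ge 2$, $L\ge 2$, $m\ge 1$, let $\mathbf a\in\mathbb Z^d$, and suppose that $P_m(\cdot,\mathbf a)$ is exact on $\mathcal T(L,d)$. Then for every $v\in(0,1]$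 with $v\ge c(d)/L$, $$\tilde D^r_\infty(\mathcal K_m(\mathbf a),v)\ \le\ C(d)\,L^{-r}\,(\log(Lv))^{d-1}.$$ -/

import Mathlib

noncomputable section

namespace FixedVolume

open MeasureTheory

/-- The half-open unit cube `Ω_d = [0,1)^d`. -/
def unitCube (d : ℕ) : Set (Fin d → ℝ) :=
  Set.pi Set.univ fun _ => Set.Ico (0 : ℝ) 1

/-- The univariate functions `h^r_u`: the function `h^1_u` is the characteristic function of
`[-u/2, u/2)` and `h^{r+1}_u` is the convolution `h^r_u * h^1_u` on the real line.
(The index `r = 0` is not used; the value there is a placeholder.) -/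
def hat : ℕ → ℝ → ℝ → ℝ
  | 0, _ => fun _ => 0
  | 1, u => Set.indicator (Set.Ico (-u / 2) (u / 2)) fun _ => (1 : ℝ)
  | r + 2, u =>
      MeasureTheory.convolution (hat (r + 1) u) (hat 1 u) (ContinuousLinearMap.mul ℝ ℝ) volume

/-- The box `B = ∏_j [c_j - r u_j / 2, c_j + r u_j / 2)` with center `c`. -/
def box {d : ℕ} (r : ℕ) (c u : Fin d → ℝ) : Set (Fin d → ℝ) :=
  Set.pi Set.univ fun j => Set.Ico (c j - r * u j / 2) (c j + r * u j / 2)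

/-- The function `h^r_B(x) = ∏_j h^r_{u_j}(x_j - c_j)` belonging to the box `B = box r c u`. -/
def boxHat {d : ℕ} (r : ℕ) (c u : Fin d → ℝ) (x : Fin d → ℝ) : ℝ :=
  ∏ j, hat r (u j) (x j - c j)

/-- The periodization `∑_{n ∈ ℤ^d} f(n + x)`, used for functions `f` of bounded support. -/
def periodize {d : ℕ} (f : (Fin d → ℝ) → ℝ) (x : Fin d → ℝ) : ℝ :=
  ∑' n : Fin d → ℤ, f (fun j => (n j : ℝ) + x j)

/-- The periodic `r`-smooth fixed volume `L_p`-discrepancy of a family `ξ` of `m` points: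
the supremum, over all boxes `B ⊆ [0,1)^d` of volume `v`, of the `L_p` norm in `z ∈ [0,1)^d`
(the essential supremum for `p = ∞`) of the equal weight integration error of the shifted
periodization of `h^r_B`. It takes values in `[0, ∞]`. -/
def periodicDiscrepancy {d m : ℕ} (r : ℕ) (p : ENNReal) (ξ : Fin m → Fin d → ℝ) (v : ℝ) :
    ENNReal :=
  ⨆ (c : Fin d → ℝ) (u : Fin d → ℝ) (_ : ∀ j, 0 < u j) (_ : box r c u ⊆ unitCube d)
    (_ : volume (box r c u) = ENNReal.ofReal v),
    eLpNorm
      (fun z : Fin d → ℝ =>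
        (∫ x in unitCube d, periodize (boxHat r c u) (x - z)) -
          (m : ℝ)⁻¹ * ∑ i, periodize (boxHat r c u) (ξ i - z))
      p (volume.restrict (unitCube d))

/-- The points `y^μ = ({μ a_1 / m}, …, {μ a_d / m})` of the Korobov point set, where
`μ = i + 1` runs through `1, …, m`. -/
def korobov {d : ℕ} (m : ℕ) (a : Fin d → ℤ) (i : Fin m) : Fin d → ℝ :=
  fun j => Int.fract ((((i : ℕ) : ℝ) + 1) * (a j : ℝ) / (m : ℝ))

/-- The Korobov cubature formula `P_m(f, a)`. -/
def cubature {d : ℕ} (m : ℕ) (a : Fin d → ℤ) (f : (Fin d → ℝ) → ℂ) : ℂ :=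
  (m : ℂ)⁻¹ * ∑ i : Fin m, f (korobov m a i)

/-- The hyperbolic cross `Γ(N, d)`. -/
def hyperbolicCross (N d : ℕ) : Set (Fin d → ℤ) :=
  {k | ∏ j, max |k j| 1 ≤ (N : ℤ)}

/-- The exponential `x ↦ exp(2πi (k, x))`. -/
def expMode {d : ℕ} (k : Fin d → ℤ) (x : Fin d → ℝ) : ℂ :=
  Complex.exp (2 * Real.pi * Complex.I * ((∑ j, (k j : ℝ) * x j : ℝ) : ℂ))

/-- The space `𝒯(N, d)` of trigonometric polynomials with frequencies in `Γ(N, d)`. -/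
def trigPoly (N d : ℕ) : Submodule ℂ ((Fin d → ℝ) → ℂ) :=
  Submodule.span ℂ (expMode '' hyperbolicCross N d)

/-- `P_m(·, a)` is exact on `𝒯(N, d)`: it integrates every such polynomial over `[0,1)^d`
without error. -/
def IsExact {d : ℕ} (m : ℕ) (a : Fin d → ℤ) (N : ℕ) : Prop :=
  ∀ f ∈ trigPoly N d, cubature m a f = ∫ x in unitCube d, f x

end FixedVolume

end

/-! ### Fourier transform of the hat functions and Poisson summation. -/

namespace FixedVolume

open MeasureTheory FourierTransform

/-! For `r ≥ 2` the periodized hat has an absolutely convergent Fourier series, and each factor of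
its coefficient at `k` is at most `min(w_j, 1/max(|k_j|,1))^r`, where `w_j = r u_j` are the side
lengths of the box, so that `∏ w_j = v`. Korobov averaging kills every frequency outside the dual
lattice, so the error is a sum over nonzero dual lattice points, uniformly in the shift `z`
(`shifted_error_eq_tsum`). Exactness says that such points satisfy `∏ max(|k_j|,1) > L`.

This allows `r - 2` factors `1/L` to be split off, leaving exponent 2. Frequencies are grouped into
dyadic blocks of size `2^(s_j)`. A box of volume at most `L` separates lattice points, so a block
contains at most a constant times `2^(∑ s_j)/L` of them (`card_lattice_block_le`). What remains is a
sum of products of one-dimensional weights over `2^(∑ s_j) > L`. Interpolation with a parameter `τ`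
decouples the coordinates and gives `L⁻² (Lv)^τ τ^(-(d-1))` up to a constant
(`sum_prod_blockWeight_le`, `sum_lattice_sq_le`). The choice `τ = 1/log(Lv)` turns this into the
power of the logarithm. -/

theorem hat_one_apply (u : ℝ) :
    hat 1 u = Set.indicator (Set.Ico (-u / 2) (u / 2)) fun _ => (1 : ℝ) := by
  rw [hat]

theorem hat_succ_succ (r : ℕ) (u : ℝ) :
    hat (r + 2) u =
      convolution (hat (r + 1) u) (hat 1 u) (ContinuousLinearMap.mul ℝ ℝ) volume := by
  conv_lhs => rw [hat]

theorem integrable_hat (r : ℕ) (u : ℝ) : Integrable (hat (r + 1) u) := by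
  have h1 : Integrable (hat 1 u) := by
    rw [hat_one_apply]
    exact (integrable_indicator_iff measurableSet_Ico).2 (integrableOn_const (by simp) (by simp))
  induction r with
  | zero => exact h1
  | succ r ih =>
    rw [hat_succ_succ]
    exact ih.integrable_convolution (ContinuousLinearMap.mul ℝ ℝ) h1

theorem hasCompactSupport_hat (r : ℕ) (u : ℝ) : HasCompactSupport (hat (r + 1) u) := by
  have h1 : HasCompactSupport (hat 1 u) := by
    refine HasCompactSupport.intro (isCompact_Icc (a := -u / 2) (b := u / 2)) fun x hx => ?_
    rw [hat_one_apply]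
    exact Set.indicator_of_notMem (fun h => hx (Set.Ico_subset_Icc_self h)) _
  induction r with
  | zero => exact h1
  | succ r ih => rw [hat_succ_succ]; exact ih.convolution _ h1

/-- Convolution with the indicator of an interval is a difference of two values of a primitive.
Continuity is needed for Poisson summation. -/
theorem continuous_hat (r : ℕ) {u : ℝ} (hu : 0 < u) : Continuous (hat (r + 2) u) := by
  have hi := integrable_hat r u
  have h : hat (r + 2) u = fun x =>
      (∫ t in (0 : ℝ)..(x + u / 2), hat (r + 1) u t) - ∫ t in (0 : ℝ)..(x - u / 2),
        hat (r + 1) u t := by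
    funext x
    rw [intervalIntegral.integral_interval_sub_left hi.intervalIntegrable hi.intervalIntegrable,
      intervalIntegral.integral_of_le (by linarith), ← integral_indicator measurableSet_Ioc,
      hat_succ_succ, convolution_def]
    congr 1
    funext t
    rw [hat_one_apply]
    simp only [Set.indicator, Set.mem_Ico, Set.mem_Ioc, ContinuousLinearMap.mul_apply']
    by_cases ht : x - u / 2 < t ∧ t ≤ x + u / 2
    · rw [if_pos ht, if_pos ⟨by linarith, by linarith⟩, mul_one]
    · rw [if_neg ht, if_neg (fun h => ht ⟨by linarith, by linarith⟩), mul_zero]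
  rw [h]
  have hc := intervalIntegral.continuous_primitive (μ := volume) (f := hat (r + 1) u)
    (fun a b => hi.intervalIntegrable) 0
  exact (hc.comp (by fun_prop)).sub (hc.comp (by fun_prop))

/-- The function `h^r_u`, regarded as complex valued. -/
noncomputable def complexHat (r : ℕ) (u : ℝ) (x : ℝ) : ℂ := (hat r u x : ℂ)

theorem complexHat_succ_succ (r : ℕ) (u : ℝ) :
    complexHat (r + 2) u =
      convolution (complexHat (r + 1) u) (complexHat 1 u) (ContinuousLinearMap.mul ℂ ℂ) volume := by
  funext x
  rw [complexHat, hat_succ_succ, convolution_def, convolution_def, ← integral_complex_ofReal]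
  simp [complexHat]

theorem integrable_complexHat (r : ℕ) (u : ℝ) : Integrable (complexHat (r + 1) u) :=
  (integrable_hat r u).ofReal

theorem fourier_complexHat (r : ℕ) (u ξ : ℝ) :
    𝓕 (complexHat (r + 1) u) ξ = 𝓕 (complexHat 1 u) ξ ^ (r + 1) := by
  induction r with
  | zero => simp
  | succ r ih =>
    rw [complexHat_succ_succ, Real.fourier_mul_convolution_eq (integrable_complexHat r u)
      (integrable_complexHat 0 u), ih, pow_succ _ (r + 1)]

theorem fourier_complexHat_one {u : ℝ} (hu : 0 < u) (ξ : ℝ) :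
    𝓕 (complexHat 1 u) ξ =
      ∫ x in (-u / 2)..(u / 2), Complex.exp ((-2 * Real.pi * ξ * Complex.I) * x) := by
  rw [Real.fourier_eq', intervalIntegral.integral_of_le (by linarith),
    ← integral_Ico_eq_integral_Ioc, ← integral_indicator measurableSet_Ico]
  congr 1
  funext x
  simp only [complexHat, hat_one_apply, Set.indicator]
  split_ifs
  · simp only [RCLike.inner_apply, conj_trivial, Complex.ofReal_mul, smul_eq_mul,
      Complex.ofReal_one, mul_one]
    congr 1
    push_cast
    ring
  · simp

theorem norm_exp_mul_I_eq_one {z : ℂ} {t : ℝ} (h : z = t * Complex.I) : ‖Complex.exp z‖ = 1 := by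
  rw [h, Complex.norm_exp_ofReal_mul_I]

theorem norm_fourier_complexHat_one_le {u : ℝ} (hu : 0 < u) (ξ : ℝ) :
    ‖𝓕 (complexHat 1 u) ξ‖ ≤ u := by
  rw [fourier_complexHat_one hu]
  refine (intervalIntegral.norm_integral_le_of_norm_le_const (C := 1) fun x _ => ?_).trans ?_
  · exact (norm_exp_mul_I_eq_one (t := -2 * Real.pi * ξ * x) (by push_cast; ring)).le
  · rw [one_mul, abs_of_nonneg] <;> linarith

theorem norm_fourier_complexHat_one_le_inv {u : ℝ} (hu : 0 < u) {ξ : ℝ} (hξ : ξ ≠ 0) :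
    ‖𝓕 (complexHat 1 u) ξ‖ ≤ 1 / |ξ| := by
  have hπ := Real.pi_pos
  have h0 : (-2 * Real.pi * ξ * Complex.I : ℂ) ≠ 0 := by
    simp [hξ, hπ.ne']
  rw [fourier_complexHat_one hu, integral_exp_mul_complex h0, norm_div]
  have hd : ‖(-2 * Real.pi * ξ * Complex.I : ℂ)‖ = 2 * Real.pi * |ξ| := by
    simp [abs_of_pos hπ]
  have hn : ∀ x : ℝ, ‖Complex.exp ((-2 * Real.pi * ξ * Complex.I) * x)‖ = 1 := fun x =>
    norm_exp_mul_I_eq_one (t := -2 * Real.pi * ξ * x) (by push_cast; ring)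
  have h2 := norm_sub_le (Complex.exp ((-2 * Real.pi * ξ * Complex.I) * (u / 2 : ℝ)))
    (Complex.exp ((-2 * Real.pi * ξ * Complex.I) * (-u / 2 : ℝ)))
  rw [hn, hn] at h2
  have hp : 0 < |ξ| := abs_pos.2 hξ
  -- The bound obtained is `1/(π|ξ|)`. Constant 1 is kept so that the `r`-th power produces no
  -- factor depending on `r`.
  rw [hd, div_le_div_iff₀ (by positivity) hp]
  nlinarith [Real.pi_gt_three]

/-- The slack `u ≤ w` is there so that `w` can later be the full side length `r u`. -/
theorem norm_fourier_complexHat_le {r : ℕ} (hr : 1 ≤ r) {u w : ℝ} (hu : 0 < u) (huw : u ≤ w)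
    (hw : w ≤ 1) (k : ℤ) :
    ‖𝓕 (complexHat r u) k‖ ≤ min w (1 / max |(k : ℝ)| 1) ^ r := by
  obtain ⟨r, rfl⟩ := Nat.exists_eq_add_of_le' hr
  rw [fourier_complexHat, norm_pow]
  refine pow_le_pow_left₀ (norm_nonneg _) (le_min ?_ ?_) _
  · exact (norm_fourier_complexHat_one_le hu _).trans huw
  · rcases eq_or_ne k 0 with rfl | hk
    · simpa using (norm_fourier_complexHat_one_le hu 0).trans (huw.trans hw)
    · have h1 : (1 : ℝ) ≤ |(k : ℝ)| := by exact_mod_cast Int.one_le_abs hk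
      rw [max_eq_left h1]
      exact norm_fourier_complexHat_one_le_inv hu (by exact_mod_cast hk)

theorem summable_norm_fourier_complexHat {r : ℕ} (hr : 2 ≤ r) {u : ℝ} (hu : 0 < u) (hu1 : u ≤ 1) :
    Summable fun k : ℤ => ‖𝓕 (complexHat r u) k‖ := by
  have h2 : Summable fun k : ℤ => 1 / (k : ℝ) ^ 2 := Real.summable_one_div_int_pow.2 one_lt_two
  refine Summable.of_norm_bounded_eventually (g := fun k : ℤ => 1 / (k : ℝ) ^ 2) h2 ?_
  have : ({0} : Set ℤ)ᶜ ∈ Filter.cofinite := (Set.finite_singleton 0).compl_mem_cofinite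
  filter_upwards [this] with k hk
  have hk : k ≠ 0 := hk
  have h1 : (1 : ℝ) ≤ |(k : ℝ)| := by exact_mod_cast Int.one_le_abs hk
  rw [norm_norm]
  refine (norm_fourier_complexHat_le (by omega) hu le_rfl hu1 k).trans ?_
  have h3 : min u (1 / max |(k : ℝ)| 1) ≤ 1 / |(k : ℝ)| := by
    rw [max_eq_left h1]; exact min_le_right _ _
  have h0 : 0 ≤ min u (1 / max |(k : ℝ)| 1) := le_min hu.le (by positivity)
  refine (pow_le_pow_of_le_one h0 ((min_le_left _ _).trans hu1) hr).trans ?_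
  refine (pow_le_pow_left₀ h0 h3 2).trans ?_
  rw [div_pow, one_pow, sq_abs]

/-- Poisson summation for `h^r_u`. -/
theorem tsum_complexHat_eq_tsum_fourier {r : ℕ} (hr : 2 ≤ r) {u : ℝ} (hu : 0 < u) (hu1 : u ≤ 1) (x : ℝ) :
    ∑' n : ℤ, complexHat r u (n + x) =
      ∑' k : ℤ, 𝓕 (complexHat r u) k * Complex.exp (2 * Real.pi * Complex.I * (k * x : ℝ)) := by
  have hs := (summable_norm_fourier_complexHat hr hu hu1).of_norm
  obtain ⟨r, rfl⟩ := Nat.exists_eq_add_of_le' hr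
  have hc : Continuous (complexHat (r + 2) u) :=
    Complex.continuous_ofReal.comp (continuous_hat r hu)
  have hO : complexHat (r + 2) u =O[Filter.cocompact ℝ] fun x : ℝ => |x| ^ (-2 : ℝ) := by
    have h0 := hasCompactSupport_iff_eventuallyEq.1 (hasCompactSupport_hat (r + 1) u)
    rw [Filter.coclosedCompact_eq_cocompact] at h0
    refine Filter.EventuallyEq.trans_isBigO (f₂ := fun _ => (0 : ℂ)) ?_
      (Asymptotics.isBigO_zero _ _)
    filter_upwards [h0] with y hy
    simpa [complexHat] using hy
  have h := Real.tsum_eq_tsum_fourier_of_rpow_decay_of_summable hc one_lt_two hO hs x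
  simp only [fourier_coe_apply] at h
  simp only [add_comm _ x]
  rw [h]
  refine tsum_congr fun k => ?_
  congr 2
  push_cast
  rw [div_one]
  ring

theorem summable_complexHat (r : ℕ) (u x : ℝ) :
    Summable fun n : ℤ => ‖complexHat (r + 1) u (n + x)‖ := by
  refine summable_of_hasFiniteSupport ?_
  have h0 := hasCompactSupport_iff_eventuallyEq.1 (hasCompactSupport_hat r u)
  rw [Filter.coclosedCompact_eq_cocompact] at h0
  have ht : Filter.Tendsto (fun n : ℤ => (n : ℝ) + x) Filter.cofinite (Filter.cocompact ℝ) :=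
    ((Homeomorph.addRight x).isClosedEmbedding.tendsto_cocompact).comp
      Int.tendsto_coe_cofinite
  have h1 := ht.eventually h0
  refine (Filter.eventually_cofinite.1 h1).subset fun n hn => ?_
  simpa [complexHat] using hn

/-- Peeling off one coordinate at a time reduces this to the product of two absolutely convergent
series. It lifts Poisson summation from one dimension to `d`, being applied on both sides. -/
theorem summable_norm_and_tsum_prod_pi {d : ℕ} {ι : Type*} (f : Fin d → ι → ℂ) (hf : ∀ j, Summable fun i => ‖f j i‖) :
    (Summable fun k : Fin d → ι => ‖∏ j, f j (k j)‖) ∧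
      ∑' k : Fin d → ι, ∏ j, f j (k j) = ∏ j, ∑' i, f j i := by
  induction d with
  | zero =>
    refine ⟨(hasSum_fintype _).summable, ?_⟩
    simp
  | succ d ih =>
    obtain ⟨h1, h2⟩ := ih (fun j => f j.succ) fun j => hf j.succ
    have he : ∀ p : ι × (Fin d → ι), ∏ j, f j ((Fin.consEquiv (fun _ : Fin (d + 1) => ι)) p j) =
        f 0 p.1 * ∏ j, f (Fin.succ j) (p.2 j) := by
      intro p
      rw [Fin.prod_univ_succ]
      simp [Fin.consEquiv]
    constructor
    · rw [← (Fin.consEquiv (fun _ : Fin (d + 1) => ι)).summable_iff]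
      refine ((hf 0).mul_norm h1).congr fun p => ?_
      simp only [Function.comp_apply, he]
    · rw [← (Fin.consEquiv (fun _ : Fin (d + 1) => ι)).tsum_eq, Fin.prod_univ_succ, ← h2,
        tsum_mul_tsum_of_summable_norm (hf 0) h1]
      exact tsum_congr he

theorem expMode_eq_prod {d : ℕ} (k : Fin d → ℤ) (x : Fin d → ℝ) :
    expMode k x = ∏ j, Complex.exp (2 * Real.pi * Complex.I * (k j * x j : ℝ)) := by
  rw [expMode, ← Complex.exp_sum]
  push_cast
  rw [Finset.mul_sum]

theorem norm_expMode {d : ℕ} (k : Fin d → ℤ) (x : Fin d → ℝ) : ‖expMode k x‖ = 1 :=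
  norm_exp_mul_I_eq_one (t := 2 * Real.pi * ∑ j, (k j : ℝ) * x j) (by push_cast; ring)

/-- The Fourier transform of the centered `h^r_B` at an integer point. -/
noncomputable def boxCoeff {d : ℕ} (r : ℕ) (u : Fin d → ℝ) (k : Fin d → ℤ) : ℂ :=
  ∏ j, 𝓕 (complexHat r (u j)) (k j)

theorem summable_norm_boxCoeff {d r : ℕ} (hr : 2 ≤ r) {u : Fin d → ℝ} (hu : ∀ j, 0 < u j)
    (hu1 : ∀ j, u j ≤ 1) : Summable fun k : Fin d → ℤ => ‖boxCoeff r u k‖ :=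
  (summable_norm_and_tsum_prod_pi _ fun j => summable_norm_fourier_complexHat hr (hu j) (hu1 j)).1

theorem periodize_boxHat {d r : ℕ} (hr : 2 ≤ r) (c : Fin d → ℝ) {u : Fin d → ℝ} (hu : ∀ j, 0 < u j)
    (hu1 : ∀ j, u j ≤ 1) (x : Fin d → ℝ) :
    (periodize (boxHat r c u) x : ℂ) = ∑' k, boxCoeff r u k * expMode k (x - c) := by
  have h1 := (summable_norm_and_tsum_prod_pi (fun j (n : ℤ) => complexHat r (u j) (n + (x j - c j))) fun j => by
    obtain ⟨r, rfl⟩ := Nat.exists_eq_add_of_le' hr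
    exact summable_complexHat (r + 1) (u j) _).2
  have h2 := (summable_norm_and_tsum_prod_pi (fun j (k : ℤ) => 𝓕 (complexHat r (u j)) k *
      Complex.exp (2 * Real.pi * Complex.I * (k * (x j - c j) : ℝ))) fun j => by
    refine (summable_norm_fourier_complexHat hr (hu j) (hu1 j)).congr fun k => ?_
    rw [norm_mul, norm_exp_mul_I_eq_one (t := 2 * Real.pi * (k * (x j - c j)))
      (by push_cast; ring), mul_one]).2
  rw [periodize, Complex.ofReal_tsum]
  calc _ = ∑' n : Fin d → ℤ, ∏ j, complexHat r (u j) (n j + (x j - c j)) := by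
        refine tsum_congr fun n => ?_
        simp only [boxHat, complexHat, Complex.ofReal_prod, add_sub_assoc]
    _ = _ := by
        rw [h1, Finset.prod_congr rfl fun j _ => tsum_complexHat_eq_tsum_fourier hr (hu j) (hu1 j) _, ← h2]
        refine tsum_congr fun k => ?_
        rw [Finset.prod_mul_distrib, expMode_eq_prod, boxCoeff]
        rfl

end FixedVolume

namespace FixedVolume

/-! ### Dyadic sums -/

/-- The weight of the dyadic block of index `s` in one coordinate. -/
noncomputable def blockWeight (w : ℝ) (s : ℕ) : ℝ := 2 ^ s * min w (2 / 2 ^ s) ^ 2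

theorem blockWeight_nonneg (w : ℝ) (s : ℕ) : 0 ≤ blockWeight w s := by
  unfold blockWeight; positivity

theorem blockWeight_le_left {w : ℝ} (hw : 0 ≤ w) (s : ℕ) : blockWeight w s ≤ w ^ 2 * 2 ^ s := by
  unfold blockWeight
  rw [mul_comm]
  gcongr
  exact min_le_left _ _

theorem blockWeight_le_right {w : ℝ} (hw : 0 ≤ w) (s : ℕ) : blockWeight w s ≤ 4 / 2 ^ s := by
  have h : min w (2 / 2 ^ s) ^ 2 ≤ (2 / 2 ^ s : ℝ) ^ 2 :=
    pow_le_pow_left₀ (le_min hw (by positivity)) (min_le_right _ _) 2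
  calc blockWeight w s ≤ 2 ^ s * (2 / 2 ^ s : ℝ) ^ 2 := by unfold blockWeight; gcongr
    _ = 4 / 2 ^ s := by field_simp; norm_num

/-- Weighted AM-GM for 1 and 1/2; it makes a geometric series of ratio `2^(-τ)` at most `2/τ`. -/
theorem two_rpow_neg_le {τ : ℝ} (h0 : 0 ≤ τ) (h1 : τ ≤ 1) : (2 : ℝ) ^ (-τ) ≤ 1 - τ / 2 := by
  have h := Real.geom_mean_le_arith_mean2_weighted (w₁ := 1 - τ) (w₂ := τ) (p₁ := 1) (p₂ := 1 / 2)
    (by linarith) h0 zero_le_one (by norm_num) (by ring)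
  rw [Real.one_rpow, one_mul, one_div, Real.inv_rpow zero_le_two, ← Real.rpow_neg zero_le_two] at h
  linarith

theorem sum_range_pow_le {q : ℝ} (h0 : 0 ≤ q) (h1 : q < 1) (N : ℕ) :
    ∑ i ∈ Finset.range N, q ^ i ≤ 1 / (1 - q) := by
  rw [one_div, ← tsum_geometric_of_lt_one h0 h1]
  exact (summable_geometric_of_lt_one h0 h1).sum_le_tsum _ fun i _ => pow_nonneg h0 i

/-- The terms peak near `2^s ≈ 1/w`. Below the peak they are dominated by a geometric series of
ratio 1/2, counted downwards; above it the ratio is only `2^(-τ)`, which is the source of `1/τ`. -/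
theorem sum_blockWeight_le {w τ : ℝ} (hw : 0 < w) (hτ : 0 < τ) (hτ1 : τ ≤ 1) (N : ℕ) :
    ∑ s ∈ Finset.range N, blockWeight w s * ((2 : ℝ) ^ s) ^ (1 - τ) ≤ 10 * (w ^ τ / τ) := by
  obtain ⟨S, hS, hS'⟩ : ∃ S : ℕ, 1 / w ≤ 2 ^ S ∧ ∀ t < S, (2 : ℝ) ^ t < 1 / w := by
    have hex : ∃ S : ℕ, 1 / w ≤ 2 ^ S :=
      (pow_unbounded_of_one_lt (1 / w) one_lt_two).imp fun _ h => h.le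
    classical
    exact ⟨Nat.find hex, Nat.find_spec hex, fun t ht => not_le.1 (Nat.find_min hex ht)⟩
  have hnn : ∀ s : ℕ, 0 ≤ blockWeight w s * ((2 : ℝ) ^ s) ^ (1 - τ) := fun s =>
    mul_nonneg (blockWeight_nonneg _ _) (by positivity)
  have hlow : ∀ t < S, blockWeight w t * ((2 : ℝ) ^ t) ^ (1 - τ) ≤
      w ^ τ * (1 / 2) ^ (S - 1 - t) := by
    intro t ht
    have hx : (2 : ℝ) ^ t * 2 ^ (S - 1 - t) ≤ 1 / w := by
      rw [← pow_add]
      exact (hS' _ (by omega)).le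
    have hx' : (2 : ℝ) ^ t ≤ (1 / w) * (1 / 2) ^ (S - 1 - t) := by
      rw [one_div_pow, mul_one_div, le_div_iff₀ (by positivity)]
      exact hx
    have h3 : ((2 : ℝ) ^ t) ^ (1 - τ) ≤ (1 / w) ^ (1 - τ) :=
      Real.rpow_le_rpow (by positivity) (hS' t ht).le (by linarith)
    have h4 : w ^ 2 * (1 / w) * (1 / w) ^ (1 - τ) = w ^ τ := by
      rw [one_div, Real.inv_rpow hw.le, ← Real.rpow_neg hw.le, ← Real.rpow_natCast,
        ← Real.rpow_neg_one, ← Real.rpow_add hw, ← Real.rpow_add hw]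
      congr 1
      push_cast
      ring
    calc blockWeight w t * ((2 : ℝ) ^ t) ^ (1 - τ)
        ≤ (w ^ 2 * ((1 / w) * (1 / 2) ^ (S - 1 - t))) * (1 / w) ^ (1 - τ) := by
          refine mul_le_mul ((blockWeight_le_left hw.le t).trans ?_) h3 (by positivity)
            (by positivity)
          gcongr
      _ = (w ^ 2 * (1 / w) * (1 / w) ^ (1 - τ)) * (1 / 2) ^ (S - 1 - t) := by ring
      _ = _ := by rw [h4]
  have hhigh : ∀ i : ℕ, blockWeight w (S + i) * ((2 : ℝ) ^ (S + i)) ^ (1 - τ) ≤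
      4 * w ^ τ * ((2 : ℝ) ^ (-τ)) ^ i := by
    intro i
    have hp : (0 : ℝ) < 2 ^ (S + i) := by positivity
    have h5 : ((2 : ℝ) ^ (S + i)) ^ (-τ) = ((2 : ℝ) ^ S) ^ (-τ) * ((2 : ℝ) ^ (-τ)) ^ i := by
      rw [pow_add, Real.mul_rpow (by positivity) (by positivity), ← Real.rpow_natCast_mul zero_le_two,
        ← Real.rpow_natCast_mul zero_le_two, ← Real.rpow_mul_natCast zero_le_two, mul_comm (-τ)]
    have h6 : ((2 : ℝ) ^ S) ^ (-τ) ≤ w ^ τ := by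
      have := Real.rpow_le_rpow_of_nonpos (z := -τ) (by positivity) hS (by linarith)
      refine this.trans_eq ?_
      rw [one_div, Real.inv_rpow hw.le, Real.rpow_neg hw.le, inv_inv]
    calc blockWeight w (S + i) * ((2 : ℝ) ^ (S + i)) ^ (1 - τ)
        ≤ 4 / 2 ^ (S + i) * ((2 : ℝ) ^ (S + i)) ^ (1 - τ) := by
          gcongr
          exact blockWeight_le_right hw.le _
      _ = 4 * (((2 : ℝ) ^ S) ^ (-τ) * ((2 : ℝ) ^ (-τ)) ^ i) := by
          rw [← h5, sub_eq_add_neg, Real.rpow_add hp, Real.rpow_one]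
          field_simp
      _ ≤ 4 * (w ^ τ * ((2 : ℝ) ^ (-τ)) ^ i) := by gcongr
      _ = _ := by ring
  have hwτ : 0 < w ^ τ := Real.rpow_pos_of_pos hw τ
  have hq := two_rpow_neg_le hτ.le hτ1
  calc ∑ s ∈ Finset.range N, blockWeight w s * ((2 : ℝ) ^ s) ^ (1 - τ)
      ≤ ∑ s ∈ Finset.range (S + N), blockWeight w s * ((2 : ℝ) ^ s) ^ (1 - τ) :=
        Finset.sum_le_sum_of_subset_of_nonneg (Finset.range_mono (by omega)) fun s _ _ => hnn s
    _ ≤ ∑ s ∈ Finset.range S, w ^ τ * (1 / 2) ^ (S - 1 - s) +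
          ∑ i ∈ Finset.range N, 4 * w ^ τ * ((2 : ℝ) ^ (-τ)) ^ i := by
        rw [Finset.sum_range_add]
        exact add_le_add (Finset.sum_le_sum fun t ht => hlow t (Finset.mem_range.1 ht))
          (Finset.sum_le_sum fun i _ => hhigh i)
    _ ≤ w ^ τ * 2 + 4 * w ^ τ * (2 / τ) := by
        rw [Finset.sum_range_reflect (fun i => w ^ τ * (1 / 2 : ℝ) ^ i), ← Finset.mul_sum,
          ← Finset.mul_sum]
        gcongr
        · exact (sum_range_pow_le (by norm_num) (by norm_num) S).trans (by norm_num)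
        · refine (sum_range_pow_le (by positivity) (by linarith) N).trans ?_
          rw [div_le_div_iff₀ (by linarith) hτ]
          linarith
    _ = 2 * w ^ τ + 8 * (w ^ τ / τ) := by ring
    _ ≤ 10 * (w ^ τ / τ) := by
        have : w ^ τ ≤ w ^ τ / τ := le_div_self hwτ.le hτ hτ1
        linarith

theorem sum_inv_two_pow_le {R : ℝ} (hR : 0 < R) (N : ℕ) :
    ∑ s ∈ Finset.range N with R < (2 : ℝ) ^ s, (1 : ℝ) / 2 ^ s ≤ 2 / R := by
  -- The subtracted tail `2/2^N` makes the induction close; the maximum with 0 covers the range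
  -- where no term is present yet.
  have key : ∑ s ∈ Finset.range N with R < (2 : ℝ) ^ s, (1 : ℝ) / 2 ^ s ≤
      max 0 (2 / R - 2 / 2 ^ N) := by
    induction N with
    | zero => simp
    | succ N ih =>
      rw [Finset.range_add_one, Finset.filter_insert]
      have hm : (2 : ℝ) / 2 ^ (N + 1) = 1 / 2 ^ N := by rw [pow_succ]; field_simp
      have hh : (2 : ℝ) / 2 ^ N = 2 * (1 / 2 ^ N) := by ring
      have hpos : (0 : ℝ) < 1 / 2 ^ N := by positivity
      rw [hm]
      rw [hh] at ih
      split_ifs with h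
      · rw [Finset.sum_insert (by simp)]
        have h1 : (1 : ℝ) / 2 ^ N < 1 / R := one_div_lt_one_div_of_lt hR h
        have h2 : 2 / R = 2 * (1 / R) := by ring
        rw [max_eq_right (by linarith)] at ih
        exact le_max_of_le_right (by linarith)
      · exact ih.trans (max_le_max le_rfl (by linarith))
  refine key.trans (max_le (by positivity) ?_)
  have : (0 : ℝ) ≤ 2 / 2 ^ N := by positivity
  linarith

/-- The tail is at most `10 w` and at most `10/R`; the geometric mean of the two bounds with weights
`τ` and `1 - τ` gives the claim, without any loss in `τ`. -/
theorem sum_blockWeight_tail_le {w τ R : ℝ} (hw : 0 < w) (hR : 0 < R) (hτ : 0 ≤ τ)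
    (hτ1 : τ ≤ 1) (N : ℕ) :
    ∑ s ∈ Finset.range N with R < (2 : ℝ) ^ s, blockWeight w s ≤
      10 * (w ^ τ * (1 / R) ^ (1 - τ)) := by
  set X := ∑ s ∈ Finset.range N with R < (2 : ℝ) ^ s, blockWeight w s with hX
  have hX0 : 0 ≤ X := Finset.sum_nonneg fun s _ => blockWeight_nonneg w s
  have h1 : X ≤ 10 * w := by
    have := sum_blockWeight_le hw one_pos le_rfl N
    simp only [sub_self, Real.rpow_zero, mul_one, Real.rpow_one, div_one] at this
    exact (Finset.sum_le_sum_of_subset_of_nonneg (Finset.filter_subset _ _)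
      fun s _ _ => blockWeight_nonneg w s).trans this
  have h2 : X ≤ 10 * (1 / R) := by
    calc X ≤ ∑ s ∈ Finset.range N with R < (2 : ℝ) ^ s, 4 * ((1 : ℝ) / 2 ^ s) := by
          refine Finset.sum_le_sum fun s _ => (blockWeight_le_right hw.le s).trans_eq (by ring)
      _ ≤ 4 * (2 / R) := by
          rw [← Finset.mul_sum]
          gcongr
          exact sum_inv_two_pow_le hR N
      _ ≤ 10 * (1 / R) := by
          rw [mul_div, mul_one_div]
          gcongr
          norm_num
  calc X = X ^ τ * X ^ (1 - τ) := by
        rcases hX0.eq_or_lt with h | h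
        · rw [← h]
          rcases hτ.eq_or_lt with h' | h'
          · simp [← h']
          · rw [Real.zero_rpow h'.ne', zero_mul]
        · rw [← Real.rpow_add h]; simp
    _ ≤ (10 * w) ^ τ * (10 * (1 / R)) ^ (1 - τ) := by
        gcongr
    _ = ((10 : ℝ) ^ τ * 10 ^ (1 - τ)) * (w ^ τ * (1 / R) ^ (1 - τ)) := by
        rw [Real.mul_rpow (by norm_num) hw.le, Real.mul_rpow (by norm_num) (by positivity)]
        ring
    _ = _ := by
        rw [← Real.rpow_add (by norm_num)]; simp

/-- Coordinate 0 is summed over its tail `2^s > L/∏ 2^(t_j)`. The tail bound turns the coupling into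
factors `(2^(t_j))^(1-τ)`, so the other `n` sums are independent. Only these cost `1/τ`, hence the
exponent `n = d - 1`. -/
theorem sum_prod_blockWeight_le {n : ℕ} {w : Fin (n + 1) → ℝ} (hw : ∀ j, 0 < w j)
    {τ L : ℝ} (hL : 0 < L) (hτ : 0 < τ) (hτ1 : τ ≤ 1) (N : ℕ) :
    ∑ s ∈ Fintype.piFinset (fun _ : Fin (n + 1) => Finset.range N) with L < ∏ j, (2 : ℝ) ^ s j,
        ∏ j, blockWeight (w j) (s j) ≤
      10 ^ (n + 1) * ((∏ j, w j) ^ τ * (1 / L) ^ (1 - τ) * (1 / τ) ^ n) := by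
  have hsplit : ∑ s ∈ Fintype.piFinset (fun _ : Fin (n + 1) => Finset.range N) with
        L < ∏ j, (2 : ℝ) ^ s j, ∏ j, blockWeight (w j) (s j) =
      ∑ t ∈ Fintype.piFinset (fun _ : Fin n => Finset.range N),
        ∑ s ∈ Finset.range N with L / ∏ j, (2 : ℝ) ^ t j < 2 ^ s,
          blockWeight (w 0) s * ∏ j, blockWeight (w j.succ) (t j) := by
    simp only [Finset.sum_filter]
    rw [← Finset.sum_product' (Fintype.piFinset (fun _ : Fin n => Finset.range N)) (Finset.range N)
      (fun t s => if L / ∏ j, (2 : ℝ) ^ t j < 2 ^ s then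
          blockWeight (w 0) s * ∏ j, blockWeight (w j.succ) (t j) else 0)]
    refine Finset.sum_bij' (fun s _ => (Fin.tail s, s 0)) (fun p _ => Fin.cons p.2 p.1) ?_ ?_ ?_ ?_ ?_
    · intro s hs
      simp only [Fintype.mem_piFinset, Finset.mem_product] at hs ⊢
      exact ⟨fun j => hs j.succ, hs 0⟩
    · intro p hp
      simp only [Fintype.mem_piFinset, Finset.mem_product] at hp ⊢
      exact fun j => Fin.cases hp.2 hp.1 j
    · intro s _
      exact Fin.cons_self_tail s
    · intro p _
      simp
    · intro s _
      simp only [Fin.prod_univ_succ, Fin.tail]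
      have hP : 0 < ∏ j : Fin n, (2 : ℝ) ^ s j.succ := Finset.prod_pos fun j _ => by positivity
      simp only [div_lt_iff₀ hP]
  rw [hsplit]
  calc _ ≤ ∑ t ∈ Fintype.piFinset (fun _ : Fin n => Finset.range N),
        (10 * (w 0 ^ τ * (1 / L) ^ (1 - τ))) *
          ∏ j, (blockWeight (w j.succ) (t j) * ((2 : ℝ) ^ t j) ^ (1 - τ)) := by
        refine Finset.sum_le_sum fun t _ => ?_
        have hP : 0 < ∏ j : Fin n, (2 : ℝ) ^ t j := Finset.prod_pos fun j _ => by positivity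
        rw [← Finset.sum_mul, Finset.prod_mul_distrib,
          Real.finsetProd_rpow _ _ (fun j _ => by positivity)]
        have hB : 0 ≤ ∏ j, blockWeight (w j.succ) (t j) :=
          Finset.prod_nonneg fun j _ => blockWeight_nonneg _ _
        have h := sum_blockWeight_tail_le (hw 0) (div_pos hL hP) hτ.le hτ1 N
        refine (mul_le_mul_of_nonneg_right h hB).trans_eq ?_
        rw [one_div_div, div_eq_mul_one_div, Real.mul_rpow hP.le (by positivity)]
        ring
    _ = (10 * (w 0 ^ τ * (1 / L) ^ (1 - τ))) * ∏ j : Fin n, ∑ s ∈ Finset.range N,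
          blockWeight (w j.succ) s * ((2 : ℝ) ^ s) ^ (1 - τ) := by
        rw [← Finset.mul_sum, Finset.prod_univ_sum]
    _ ≤ (10 * (w 0 ^ τ * (1 / L) ^ (1 - τ))) * ∏ j : Fin n, 10 * (w j.succ ^ τ / τ) := by
        have h0 := (hw 0).le
        gcongr with j
        · intro j _
          exact Finset.sum_nonneg fun s _ => mul_nonneg (blockWeight_nonneg _ _) (by positivity)
        · exact sum_blockWeight_le (hw _) hτ hτ1 N
    _ = _ := by
        rw [Fin.prod_univ_succ, Real.mul_rpow (hw 0).le (Finset.prod_nonneg fun j _ => (hw _).le),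
          ← Real.finsetProd_rpow _ _ (fun j _ => (hw _).le)]
        simp only [one_div, div_eq_mul_inv _ τ, Finset.prod_mul_distrib, Finset.prod_const,
          Finset.card_univ, Fintype.card_fin, pow_succ]
        ring

end FixedVolume

namespace FixedVolume

/-! ### Lattice points in dyadic blocks -/

theorem exists_le_sum_eq {d : ℕ} (s : Fin d → ℕ) (n : ℕ) (hn : n ≤ ∑ j, s j) :
    ∃ t : Fin d → ℕ, (∀ j, t j ≤ s j) ∧ ∑ j, t j = n := by
  induction n with
  | zero => exact ⟨fun _ => 0, fun j => Nat.zero_le _, by simp⟩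
  | succ n ih =>
    obtain ⟨t, ht, hsum⟩ := ih (by omega)
    obtain ⟨i, -, hi⟩ : ∃ i ∈ Finset.univ, t i < s i :=
      Finset.exists_lt_of_sum_lt (by omega)
    refine ⟨t + Pi.single i 1, fun j => ?_, ?_⟩
    · rcases eq_or_ne j i with rfl | h
      · simpa using hi
      · simpa [h] using ht j
    · simp [Finset.sum_add_distrib, hsum]

/-- Pigeonhole: the block is tiled by cells of sides `2^(t_j)` with `∑ t_j = Nat.log 2 L`. Two
lattice points in one cell would differ by a nonzero lattice vector with product at most `L`. -/
theorem card_lattice_block_le {d : ℕ} (Λ : AddSubgroup (Fin d → ℤ)) {L : ℕ} (hL : 1 ≤ L)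
    (hΛ : ∀ k ∈ Λ, k ≠ 0 → (L : ℤ) < ∏ j, max |k j| 1) (s : Fin d → ℕ) (hs : L < 2 ^ ∑ j, s j)
    (F : Finset (Fin d → ℤ)) (hF : ∀ k ∈ F, k ∈ Λ ∧ ∀ j, |k j| < 2 ^ s j) :
    F.card * L ≤ 2 ^ (d + 1) * 2 ^ ∑ j, s j := by
  have hL2 : L < 2 ^ (Nat.log 2 L + 1) := Nat.lt_pow_succ_log_self one_lt_two L
  have hL1 : 2 ^ Nat.log 2 L ≤ L := Nat.pow_log_le_self 2 (by omega)
  have hlog : Nat.log 2 L ≤ ∑ j, s j :=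
    ((Nat.pow_lt_pow_iff_right one_lt_two).1 (hL1.trans_lt hs)).le
  obtain ⟨t, hts, ht⟩ := exists_le_sum_eq s _ hlog
  have hcard : F.card ≤ (Fintype.piFinset fun j =>
      Finset.Ico (-2 ^ (s j - t j) : ℤ) (2 ^ (s j - t j))).card := by
    refine Finset.card_le_card_of_injOn (fun k j => k j / 2 ^ t j) ?_ ?_
    · intro k hk
      rw [Finset.mem_coe, Fintype.mem_piFinset]
      intro j
      have hj := abs_lt.1 ((hF k hk).2 j)
      have hp : (0 : ℤ) < 2 ^ t j := by positivity
      have hst : (2 : ℤ) ^ s j = 2 ^ (s j - t j) * 2 ^ t j := by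
        rw [← pow_add, Nat.sub_add_cancel (hts j)]
      rw [hst] at hj
      rw [Finset.mem_Ico, Int.le_ediv_iff_mul_le hp, Int.ediv_lt_iff_lt_mul hp]
      exact ⟨by linarith, by linarith⟩
    · intro k hk l hl hkl
      by_contra hne
      have hmem : k - l ∈ Λ := Λ.sub_mem (hF k hk).1 (hF l hl).1
      refine absurd (hΛ _ hmem (sub_ne_zero.2 hne)) (not_lt.2 ?_)
      calc ∏ j, max |(k - l) j| 1 ≤ ∏ j, (2 : ℤ) ^ t j := by
            refine Finset.prod_le_prod (fun j _ => by positivity) fun j _ => ?_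
            have hp : (0 : ℤ) < 2 ^ t j := by positivity
            refine max_le ?_ (by omega)
            have h1 : k j / 2 ^ t j = l j / 2 ^ t j := congrFun hkl j
            have h2 := Int.mul_ediv_add_emod (k j) (2 ^ t j)
            have h3 := Int.mul_ediv_add_emod (l j) (2 ^ t j)
            have h4 := Int.emod_nonneg (k j) hp.ne'
            have h5 := Int.emod_nonneg (l j) hp.ne'
            have h6 := Int.emod_lt_of_pos (k j) hp
            have h7 := Int.emod_lt_of_pos (l j) hp
            rw [h1] at h2
            rw [Pi.sub_apply, abs_le]
            constructor <;> linarith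
        _ ≤ L := by
            rw [Finset.prod_pow_eq_pow_sum, ht]
            exact_mod_cast hL1
  have hbox : (Fintype.piFinset fun j =>
      Finset.Ico (-2 ^ (s j - t j) : ℤ) (2 ^ (s j - t j))).card * 2 ^ Nat.log 2 L =
        2 ^ d * 2 ^ ∑ j, s j := by
    have h1 : ∀ j, (Finset.Ico (-2 ^ (s j - t j) : ℤ) (2 ^ (s j - t j))).card =
        2 * 2 ^ (s j - t j) := by
      intro j
      rw [Int.card_Ico]
      have : (2 ^ (s j - t j) - -2 ^ (s j - t j) : ℤ) = ((2 * 2 ^ (s j - t j) : ℕ) : ℤ) := by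
        push_cast; ring
      rw [this, Int.toNat_natCast]
    have h2 : ∑ j, (s j - t j) + ∑ j, t j = ∑ j, s j := by
      rw [← Finset.sum_add_distrib]
      exact Finset.sum_congr rfl fun j _ => Nat.sub_add_cancel (hts j)
    rw [Fintype.card_piFinset, Finset.prod_congr rfl fun j _ => h1 j, Finset.prod_mul_distrib,
      Finset.prod_pow_eq_pow_sum, ← h2, ← ht, pow_add]
    simp [mul_assoc]
  calc F.card * L ≤ F.card * (2 * 2 ^ Nat.log 2 L) := by
        refine Nat.mul_le_mul_left _ ?_
        rw [pow_succ] at hL2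
        omega
    _ ≤ _ * (2 * 2 ^ Nat.log 2 L) := Nat.mul_le_mul_right _ hcard
    _ = 2 * (_ * 2 ^ Nat.log 2 L) := by ring
    _ = _ := by rw [hbox, pow_succ]; ring

theorem abs_lt_two_pow_size (k : ℤ) : |k| < 2 ^ k.natAbs.size := by
  rw [Int.abs_eq_natAbs]
  exact_mod_cast Nat.lt_size_self _

/-- The binary length serves as dyadic index; `k = 0` has length 0. -/
theorem one_div_max_abs_le (k : ℤ) : 1 / max |(k : ℝ)| 1 ≤ 2 / 2 ^ k.natAbs.size := by
  rw [div_le_div_iff₀ (by positivity) (by positivity), one_mul]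
  rcases h : k.natAbs.size with _ | s
  · rw [pow_zero]
    linarith [le_max_right |(k : ℝ)| 1]
  · have h1 : 2 ^ s ≤ k.natAbs := Nat.lt_size.1 (by omega)
    have h2 : (2 : ℝ) ^ s ≤ |(k : ℝ)| := by
      rw [← Int.cast_abs, Int.abs_eq_natAbs]
      exact_mod_cast h1
    rw [pow_succ]
    linarith [le_max_left |(k : ℝ)| 1]

/-- Fibering over the binary lengths, only blocks with `∏ 2^(s_j) > L` occur, and each contributes
its point count times a squared product, that is, `1/L` times a product of block weights up to a
constant. -/
theorem sum_lattice_sq_le {n : ℕ} (Λ : AddSubgroup (Fin (n + 1) → ℤ)) {L : ℕ} (hL : 1 ≤ L)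
    (hΛ : ∀ k ∈ Λ, k ≠ 0 → (L : ℤ) < ∏ j, max |k j| 1) {w : Fin (n + 1) → ℝ} (hw : ∀ j, 0 < w j)
    {τ : ℝ} (hτ : 0 < τ) (hτ1 : τ ≤ 1) (F : Finset (Fin (n + 1) → ℤ))
    (hF : ∀ k ∈ F, k ∈ Λ ∧ k ≠ 0) :
    ∑ k ∈ F, (∏ j, min (w j) (1 / max |(k j : ℝ)| 1)) ^ 2 ≤
      40 ^ (n + 1) * ((L * ∏ j, w j) ^ τ * (1 / τ) ^ n) / (L : ℝ) ^ 2 := by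
  classical
  have hL0 : (0 : ℝ) < L := by exact_mod_cast hL
  set σ : (Fin (n + 1) → ℤ) → Fin (n + 1) → ℕ := fun k j => (k j).natAbs.size with hσ
  set N := F.sup (fun k => Finset.univ.sup (σ k)) + 1 with hN
  have hprod : ∀ k ∈ F, (L : ℤ) < ∏ j, (2 : ℤ) ^ σ k j := by
    intro k hk
    refine (hΛ k (hF k hk).1 (hF k hk).2).trans_le ?_
    refine Finset.prod_le_prod (fun j _ => by positivity) fun j _ => ?_
    exact max_le (abs_lt_two_pow_size _).le (one_le_pow₀ (by norm_num))
  have hmaps : ∀ k ∈ F, σ k ∈ (Fintype.piFinset (fun _ : Fin (n + 1) => Finset.range N)).filter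
      fun s => (L : ℝ) < ∏ j, (2 : ℝ) ^ s j := by
    intro k hk
    rw [Finset.mem_filter, Fintype.mem_piFinset]
    refine ⟨fun j => ?_, by exact_mod_cast hprod k hk⟩
    rw [Finset.mem_range, hN, Nat.lt_succ_iff]
    exact (Finset.le_sup (f := σ k) (Finset.mem_univ j)).trans
      (Finset.le_sup (f := fun k => Finset.univ.sup (σ k)) hk)
  rw [← Finset.sum_fiberwise_of_maps_to hmaps]
  have hblock : ∀ s ∈ (Fintype.piFinset (fun _ : Fin (n + 1) => Finset.range N)).filter
      (fun s => (L : ℝ) < ∏ j, (2 : ℝ) ^ s j),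
      ∑ k ∈ F with σ k = s, (∏ j, min (w j) (1 / max |(k j : ℝ)| 1)) ^ 2 ≤
        2 ^ (n + 2) / L * ∏ j, blockWeight (w j) (s j) := by
    intro s hs
    have hsL : L < 2 ^ ∑ j, s j := by
      have := (Finset.mem_filter.1 hs).2
      rw [Finset.prod_pow_eq_pow_sum] at this
      exact_mod_cast this
    have hc := card_lattice_block_le Λ hL hΛ s hsL (F.filter fun k => σ k = s) (by
      intro k hk
      obtain ⟨hkF, rfl⟩ := Finset.mem_filter.1 hk
      exact ⟨(hF k hkF).1, fun j => abs_lt_two_pow_size _⟩)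
    have hc' : ((F.filter fun k => σ k = s).card : ℝ) ≤ 2 ^ (n + 2) / L * ∏ j, (2 : ℝ) ^ s j := by
      rw [div_mul_eq_mul_div, le_div_iff₀ hL0, Finset.prod_pow_eq_pow_sum]
      exact_mod_cast hc
    calc _ ≤ ∑ k ∈ F with σ k = s, (∏ j, min (w j) (2 / 2 ^ s j)) ^ 2 := by
          refine Finset.sum_le_sum fun k hk => ?_
          obtain ⟨-, rfl⟩ := Finset.mem_filter.1 hk
          have h0 : ∀ j, 0 ≤ min (w j) (1 / max |(k j : ℝ)| 1) := fun j =>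
            le_min (hw j).le (by positivity)
          refine pow_le_pow_left₀ (Finset.prod_nonneg fun j _ => h0 j) ?_ 2
          exact Finset.prod_le_prod (fun j _ => h0 j) fun j _ =>
            min_le_min le_rfl (one_div_max_abs_le _)
      _ ≤ (2 ^ (n + 2) / L * ∏ j, (2 : ℝ) ^ s j) * (∏ j, min (w j) (2 / 2 ^ s j)) ^ 2 := by
          rw [Finset.sum_const, nsmul_eq_mul]
          gcongr
      _ = _ := by
          simp only [blockWeight, Finset.prod_mul_distrib, Finset.prod_pow]
          ring
  have hsum := sum_prod_blockWeight_le hw hL0 hτ hτ1 N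
  have hW : 0 ≤ ∏ j, w j := Finset.prod_nonneg fun j _ => (hw j).le
  calc _ ≤ _ := Finset.sum_le_sum hblock
    _ ≤ 2 ^ (n + 2) / L *
        (10 ^ (n + 1) * ((∏ j, w j) ^ τ * (1 / L : ℝ) ^ (1 - τ) * (1 / τ) ^ n)) := by
        rw [← Finset.mul_sum]
        gcongr
    _ = (2 ^ (n + 2) * 10 ^ (n + 1)) * ((L * ∏ j, w j) ^ τ * (1 / τ) ^ n) / (L : ℝ) ^ 2 := by
        rw [Real.mul_rpow hL0.le hW, Real.rpow_sub (by positivity), Real.rpow_one,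
          one_div (L : ℝ), Real.inv_rpow hL0.le]
        field_simp
    _ ≤ _ := by
        have h40 : (2 : ℝ) ^ (n + 2) * 10 ^ (n + 1) ≤ 40 ^ (n + 1) := by
          have : (40 : ℝ) ^ (n + 1) = 2 ^ (n + 1) * 2 ^ (n + 1) * 10 ^ (n + 1) := by
            rw [← mul_pow, ← mul_pow]; norm_num
          rw [this, pow_succ 2 (n + 1)]
          gcongr
          exact le_self_pow₀ (by norm_num) (by omega)
        gcongr

theorem sum_lattice_pow_le {n : ℕ} (Λ : AddSubgroup (Fin (n + 1) → ℤ)) {L : ℕ} (hL : 1 ≤ L)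
    (hΛ : ∀ k ∈ Λ, k ≠ 0 → (L : ℤ) < ∏ j, max |k j| 1) {w : Fin (n + 1) → ℝ} (hw : ∀ j, 0 < w j)
    (hlog : 1 ≤ Real.log (L * ∏ j, w j)) {r : ℕ} (hr : 2 ≤ r) (F : Finset (Fin (n + 1) → ℤ))
    (hF : ∀ k ∈ F, k ∈ Λ ∧ k ≠ 0) :
    ∑ k ∈ F, (∏ j, min (w j) (1 / max |(k j : ℝ)| 1)) ^ r ≤
      40 ^ (n + 1) * Real.exp 1 * ((L : ℝ) ^ r)⁻¹ * Real.log (L * ∏ j, w j) ^ n := by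
  have hL0 : (0 : ℝ) < L := by exact_mod_cast hL
  have hW : 0 < ∏ j, w j := Finset.prod_pos fun j _ => hw j
  set ℓ := Real.log (L * ∏ j, w j) with hℓ
  have hℓ0 : 0 < ℓ := one_pos.trans_le hlog
  have hmain := sum_lattice_sq_le Λ hL hΛ hw (τ := 1 / ℓ) (by positivity)
    ((div_le_one hℓ0).2 hlog) F hF
  have hexp : (L * ∏ j, w j) ^ (1 / ℓ) = Real.exp 1 := by
    rw [Real.rpow_def_of_pos (by positivity), ← hℓ, mul_one_div_cancel hℓ0.ne']
  -- With `τ = 1/ℓ` the power `(L ∏ w_j)^τ` is just `e`, while `(1/τ)^n` is `ℓ^n`.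
  rw [hexp, one_div_one_div] at hmain
  have hterm : ∀ k ∈ F, (∏ j, min (w j) (1 / max |(k j : ℝ)| 1)) ^ r ≤
      (1 / L : ℝ) ^ (r - 2) * (∏ j, min (w j) (1 / max |(k j : ℝ)| 1)) ^ 2 := by
    intro k hk
    have h0 : ∀ j, 0 ≤ min (w j) (1 / max |(k j : ℝ)| 1) := fun j =>
      le_min (hw j).le (by positivity)
    have h1 : ∏ j, min (w j) (1 / max |(k j : ℝ)| 1) ≤ 1 / L := by
      calc _ ≤ ∏ j, 1 / max |(k j : ℝ)| 1 :=
            Finset.prod_le_prod (fun j _ => h0 j) fun j _ => min_le_right _ _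
        _ ≤ 1 / L := by
            rw [Finset.prod_div_distrib, Finset.prod_const_one]
            refine one_div_le_one_div_of_le hL0 ?_
            exact_mod_cast (hΛ k (hF k hk).1 (hF k hk).2).le
    rw [← Nat.sub_add_cancel hr, pow_add, Nat.add_sub_cancel]
    gcongr
    exact Finset.prod_nonneg fun j _ => h0 j
  calc _ ≤ _ := Finset.sum_le_sum hterm
    _ ≤ (1 / L : ℝ) ^ (r - 2) * (40 ^ (n + 1) * (Real.exp 1 * ℓ ^ n) / (L : ℝ) ^ 2) := by
        rw [← Finset.mul_sum]
        gcongr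
    _ = _ := by
        have : (L : ℝ) ^ r = L ^ (r - 2) * L ^ 2 := by rw [← pow_add, Nat.sub_add_cancel hr]
        rw [this, one_div_pow]
        field_simp

end FixedVolume

namespace FixedVolume

open MeasureTheory FourierTransform

/-! ### The cubature error of exponentials -/

theorem expMode_add_right {d : ℕ} (k : Fin d → ℤ) (x y : Fin d → ℝ) :
    expMode k (x + y) = expMode k x * expMode k y := by
  simp only [expMode_eq_prod, ← Finset.prod_mul_distrib, ← Complex.exp_add]
  refine Finset.prod_congr rfl fun j _ => congrArg _ ?_
  simp only [Pi.add_apply]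
  push_cast
  ring

theorem expMode_add_left {d : ℕ} (k l : Fin d → ℤ) (x : Fin d → ℝ) :
    expMode (k + l) x = expMode k x * expMode l x := by
  simp only [expMode_eq_prod, ← Finset.prod_mul_distrib, ← Complex.exp_add]
  refine Finset.prod_congr rfl fun j _ => congrArg _ ?_
  simp only [Pi.add_apply]
  push_cast
  ring

theorem expMode_zero {d : ℕ} (x : Fin d → ℝ) : expMode (0 : Fin d → ℤ) x = 1 := by
  simp [expMode]

theorem expMode_neg_mul {d : ℕ} (k : Fin d → ℤ) (x : Fin d → ℝ) :
    expMode (-k) x * expMode k x = 1 := by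
  rw [← expMode_add_left, neg_add_cancel, expMode_zero]

theorem expMode_intCast {d : ℕ} (k n : Fin d → ℤ) : expMode k (fun j => (n j : ℝ)) = 1 := by
  rw [expMode, Complex.exp_eq_one_iff]
  refine ⟨∑ j, k j * n j, ?_⟩
  push_cast
  ring

theorem expMode_nsmul {d : ℕ} (k : Fin d → ℤ) (x : Fin d → ℝ) (n : ℕ) :
    expMode k (n • x) = expMode k x ^ n := by
  induction n with
  | zero => simp [expMode]
  | succ n ih => rw [succ_nsmul, expMode_add_right, ih, pow_succ]

theorem continuous_expMode {d : ℕ} (k : Fin d → ℤ) : Continuous (expMode k) := by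
  unfold expMode
  fun_prop

theorem volume_unitCube (d : ℕ) : volume (unitCube d) = 1 := by
  rw [unitCube, Real.volume_pi_Ico]
  simp

theorem integral_expMode {d : ℕ} {k : Fin d → ℤ} (hk : k ≠ 0) :
    ∫ x in unitCube d, expMode k x = 0 := by
  obtain ⟨i, hi⟩ := Function.ne_iff.1 hk
  simp only [expMode_eq_prod]
  rw [unitCube, volume_pi, Measure.restrict_pi_pi, integral_fintype_prod_eq_prod
    (f := fun j (x : ℝ) => Complex.exp (2 * Real.pi * Complex.I * (k j * x : ℝ)))]
  refine Finset.prod_eq_zero (Finset.mem_univ i) ?_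
  have hi' : (k i : ℂ) ≠ 0 := by exact_mod_cast hi
  have h0 : (2 * Real.pi * Complex.I * k i : ℂ) ≠ 0 := by
    have := Real.pi_ne_zero
    simp [hi', this]
  have h1 := integral_exp_mul_complex (a := 0) (b := 1) h0
  rw [intervalIntegral.integral_of_le zero_le_one, ← integral_Ico_eq_integral_Ioc] at h1
  have h2 : Complex.exp (2 * Real.pi * Complex.I * k i) = 1 :=
    Complex.exp_eq_one_iff.2 ⟨k i, by ring⟩
  simp only [Complex.ofReal_one, mul_one, Complex.ofReal_zero, mul_zero, Complex.exp_zero, h2,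
    sub_self, zero_div] at h1
  rw [← h1]
  congr 1
  funext x
  congr 1
  push_cast
  ring

/-- The dual lattice of the Korobov points. -/
def dualLattice {d : ℕ} (m : ℕ) (a : Fin d → ℤ) : AddSubgroup (Fin d → ℤ) where
  carrier := {k | expMode k (fun j => (a j : ℝ) / m) = 1}
  zero_mem' := expMode_zero _
  add_mem' {k l} hk hl := by
    rw [Set.mem_ofPred_eq] at hk hl ⊢
    rw [expMode_add_left, hk, hl, one_mul]
  neg_mem' {k} hk := by
    rw [Set.mem_ofPred_eq] at hk ⊢
    simpa [hk] using expMode_neg_mul k (fun j => (a j : ℝ) / m)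

theorem expMode_korobov {d m : ℕ} (a k : Fin d → ℤ) (i : Fin m) :
    expMode k (korobov m a i) = expMode k (fun j => (a j : ℝ) / m) ^ ((i : ℕ) + 1) := by
  -- Taking fractional parts subtracts an integer vector, which exponentials do not see.
  have h : ((i : ℕ) + 1) • (fun j => (a j : ℝ) / m) = korobov m a i +
      fun j => ((⌊(((i : ℕ) : ℝ) + 1) * (a j : ℝ) / (m : ℝ)⌋ : ℤ) : ℝ) := by
    funext j
    simp only [korobov, Pi.add_apply, Pi.smul_apply, nsmul_eq_mul, Int.fract_add_floor]
    push_cast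
    ring
  rw [← expMode_nsmul, h, expMode_add_right, expMode_intCast, mul_one]

theorem cubature_expMode_of_mem {d m : ℕ} (hm : 1 ≤ m) {a k : Fin d → ℤ}
    (hk : k ∈ dualLattice m a) : cubature m a (expMode k) = 1 := by
  have hk' : expMode k (fun j => (a j : ℝ) / m) = 1 := hk
  have hm0 : (m : ℂ) ≠ 0 := by exact_mod_cast (by omega : m ≠ 0)
  simp [cubature, expMode_korobov, hk', hm0]

/-- The values are the powers of an `m`-th root of unity other than 1, so their geometric sum
vanishes. -/
theorem cubature_expMode_of_notMem {d m : ℕ} (hm : 1 ≤ m) {a k : Fin d → ℤ}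
    (hk : k ∉ dualLattice m a) : cubature m a (expMode k) = 0 := by
  set ζ := expMode k (fun j => (a j : ℝ) / m) with hζ
  have hk' : ζ ≠ 1 := hk
  have hm0 : (m : ℝ) ≠ 0 := by exact_mod_cast (by omega : m ≠ 0)
  have hpow : ζ ^ m = 1 := by
    rw [hζ, ← expMode_nsmul, ← expMode_intCast k a]
    congr 1
    funext j
    simp only [Pi.smul_apply, nsmul_eq_mul]
    field_simp
  simp only [cubature, expMode_korobov, ← hζ]
  rw [Fin.sum_univ_eq_sum_range (fun i => ζ ^ (i + 1)) m]
  simp only [pow_succ, ← Finset.sum_mul]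
  rw [geom_sum_eq hk', hpow]
  simp

theorem lt_prod_of_mem_dualLattice {d m L : ℕ} (hm : 1 ≤ m) {a : Fin d → ℤ} (h : IsExact m a L)
    {k : Fin d → ℤ} (hk : k ∈ dualLattice m a) (hk0 : k ≠ 0) : (L : ℤ) < ∏ j, max |k j| 1 := by
  by_contra hlt
  have := h (expMode k) (Submodule.subset_span ⟨k, not_lt.1 hlt, rfl⟩)
  rw [cubature_expMode_of_mem hm hk, integral_expMode hk0] at this
  exact one_ne_zero this

/-- The integration error of the Korobov cubature formula at the exponential of frequency `k`. -/
noncomputable def modeError {d : ℕ} (m : ℕ) (a k : Fin d → ℤ) : ℂ :=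
  (∫ x in unitCube d, expMode k x) - cubature m a (expMode k)

theorem modeError_eq_zero {d m : ℕ} (hm : 1 ≤ m) {a k : Fin d → ℤ}
    (hk : ¬(k ∈ dualLattice m a ∧ k ≠ 0)) : modeError m a k = 0 := by
  unfold modeError
  by_cases hk0 : k = 0
  · subst hk0
    rw [cubature_expMode_of_mem hm (zero_mem _)]
    simp [expMode_zero, Measure.real, volume_unitCube]
  · rw [integral_expMode hk0, cubature_expMode_of_notMem hm fun h => hk ⟨h, hk0⟩, sub_zero]

theorem norm_modeError_le {d m : ℕ} (hm : 1 ≤ m) (a k : Fin d → ℤ) : ‖modeError m a k‖ ≤ 1 := by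
  by_cases hk : k ∈ dualLattice m a ∧ k ≠ 0
  · simp [modeError, integral_expMode hk.2, cubature_expMode_of_mem hm hk.1]
  · simp [modeError_eq_zero hm hk]

/-! ### Fourier expansion of the shifted error and assembly of the bound. -/

theorem shifted_error_eq_tsum {d r m : ℕ} (hr : 2 ≤ r) (a : Fin d → ℤ) (c : Fin d → ℝ)
    {u : Fin d → ℝ} (hu : ∀ j, 0 < u j) (hu1 : ∀ j, u j ≤ 1) (z : Fin d → ℝ) :
    (((∫ x in unitCube d, periodize (boxHat r c u) (x - z)) -
      (m : ℝ)⁻¹ * ∑ i, periodize (boxHat r c u) (korobov m a i - z) : ℝ) : ℂ) =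
      ∑' k, boxCoeff r u k * expMode k (-z - c) * modeError m a k := by
  have hper : ∀ x, (periodize (boxHat r c u) (x - z) : ℂ) =
      ∑' k, boxCoeff r u k * expMode k (-z - c) * expMode k x := by
    intro x
    rw [periodize_boxHat hr c hu hu1]
    refine tsum_congr fun k => ?_
    rw [show x - z - c = x + (-z - c) by abel, expMode_add_right]
    ring
  have hsum := summable_norm_boxCoeff hr hu hu1
  have hnorm : ∀ k x, ‖boxCoeff r u k * expMode k (-z - c) * expMode k x‖ = ‖boxCoeff r u k‖ := by
    intro k x
    rw [norm_mul, norm_mul, norm_expMode, norm_expMode, mul_one, mul_one]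
  have hfin : IsFiniteMeasure (volume.restrict (unitCube d)) :=
    ⟨by rw [Measure.restrict_apply_univ, volume_unitCube]; exact ENNReal.one_lt_top⟩
  have hint := hasSum_integral_of_summable_integral_norm (μ := volume.restrict (unitCube d))
    (F := fun k x => boxCoeff r u k * expMode k (-z - c) * expMode k x)
    (fun k => Integrable.of_bound
      (((continuous_expMode k).const_mul _).aestronglyMeasurable) ‖boxCoeff r u k‖
      (Filter.Eventually.of_forall fun x => (hnorm k x).le))
    (by
      simp only [hnorm]
      simpa [Measure.real, volume_unitCube] using hsum)
  have hcub := hasSum_sum (s := (Finset.univ : Finset (Fin m)))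
    (f := fun i k => boxCoeff r u k * expMode k (-z - c) * expMode k (korobov m a i))
    fun i _ => (Summable.of_norm (by simpa only [hnorm] using hsum)).hasSum
  have hE := hint.sub (hcub.mul_left (m : ℂ)⁻¹)
  push_cast
  rw [← integral_complex_ofReal]
  simp only [hper]
  rw [← hE.tsum_eq]
  refine tsum_congr fun k => ?_
  rw [integral_const_mul, ← Finset.mul_sum, modeError, cubature]
  ring

theorem norm_boxCoeff_le {d r : ℕ} (hr : 1 ≤ r) {u w : Fin d → ℝ} (hu : ∀ j, 0 < u j)
    (huw : ∀ j, u j ≤ w j) (hw : ∀ j, w j ≤ 1) (k : Fin d → ℤ) :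
    ‖boxCoeff r u k‖ ≤ (∏ j, min (w j) (1 / max |(k j : ℝ)| 1)) ^ r := by
  rw [boxCoeff, norm_prod, ← Finset.prod_pow]
  exact Finset.prod_le_prod (fun j _ => norm_nonneg _) fun j _ =>
    norm_fourier_complexHat_le hr (hu j) (huw j) (hw j) (k j)

theorem norm_shifted_error_le {n r m L : ℕ} (hr : 2 ≤ r) (hL : 1 ≤ L) (hm : 1 ≤ m)
    {a : Fin (n + 1) → ℤ} (h : IsExact m a L) (c : Fin (n + 1) → ℝ) {u w : Fin (n + 1) → ℝ}
    (hu : ∀ j, 0 < u j) (huw : ∀ j, u j ≤ w j) (hw : ∀ j, w j ≤ 1)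
    (hlog : 1 ≤ Real.log (L * ∏ j, w j)) (z : Fin (n + 1) → ℝ) :
    ‖(∫ x in unitCube (n + 1), periodize (boxHat r c u) (x - z)) -
      (m : ℝ)⁻¹ * ∑ i, periodize (boxHat r c u) (korobov m a i - z)‖ ≤
      40 ^ (n + 1) * Real.exp 1 * ((L : ℝ) ^ r)⁻¹ * Real.log (L * ∏ j, w j) ^ n := by
  classical
  have hw0 : ∀ j, 0 < w j := fun j => (hu j).trans_le (huw j)
  rw [← Complex.norm_real,
    shifted_error_eq_tsum hr a c hu (fun j => (huw j).trans (hw j)) z]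
  -- A bound uniform over finite sets yields both summability and the bound on the full series.
  have hbound : ∀ F : Finset (Fin (n + 1) → ℤ),
      ∑ k ∈ F, ‖boxCoeff r u k * expMode k (-z - c) * modeError m a k‖ ≤
        40 ^ (n + 1) * Real.exp 1 * ((L : ℝ) ^ r)⁻¹ * Real.log (L * ∏ j, w j) ^ n := by
    intro F
    refine le_trans ?_ (sum_lattice_pow_le (dualLattice m a) hL
      (fun k hk hk0 => lt_prod_of_mem_dualLattice hm h hk hk0) hw0 hlog hr
      (F.filter fun k => k ∈ dualLattice m a ∧ k ≠ 0) fun k hk => (Finset.mem_filter.1 hk).2)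
    rw [Finset.sum_filter]
    refine Finset.sum_le_sum fun k _ => ?_
    split_ifs with hk
    · rw [norm_mul, norm_mul, norm_expMode, mul_one]
      refine (mul_le_of_le_one_right (norm_nonneg _) (norm_modeError_le hm a k)).trans ?_
      exact norm_boxCoeff_le (by omega) hu huw hw k
    · rw [modeError_eq_zero hm hk, mul_zero, norm_zero]
  have hs := summable_of_sum_le (fun k => norm_nonneg _) hbound
  exact (norm_tsum_le_tsum_norm hs).trans (hs.tsum_le_of_sum_le hbound)

theorem box_side_le_one {d r : ℕ} (hr : 1 ≤ r) {c u : Fin d → ℝ} (hu : ∀ j, 0 < u j)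
    (hB : box r c u ⊆ unitCube d) (j : Fin d) : r * u j ≤ 1 := by
  have hr0 : (0 : ℝ) < r := by exact_mod_cast hr
  have hlt : ∀ j, c j - r * u j / 2 < c j + r * u j / 2 := fun j => by
    have := mul_pos hr0 (hu j)
    linarith
  rcases Set.univ_pi_subset_univ_pi_iff.1 hB with h | ⟨i, hi⟩
  · have := (Set.Ico_subset_Ico_iff (hlt j)).1 (h j)
    linarith
  · exact absurd hi (Set.nonempty_Ico.2 (hlt i)).ne_empty

theorem prod_box_side {d r : ℕ} {c u : Fin d → ℝ} (hu : ∀ j, 0 < u j) {v : ℝ} (hv : 0 ≤ v)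
    (hB : volume (box r c u) = ENNReal.ofReal v) : ∏ j, r * u j = v := by
  have h0 : ∀ j, 0 ≤ r * u j := fun j => mul_nonneg r.cast_nonneg (hu j).le
  rw [box, Real.volume_pi_Ico, ← ENNReal.ofReal_prod_of_nonneg
    (fun j _ => by have := h0 j; linarith)] at hB
  rw [← (ENNReal.ofReal_eq_ofReal_iff (Finset.prod_nonneg fun j _ => by have := h0 j; linarith)
    hv).1 hB]
  exact Finset.prod_congr rfl fun j _ => by ring

end FixedVolume

theorem theorem1p5 (d : ℕ) (hd : 1 ≤ d) :
    ∃ c C : ℝ, 0 < c ∧ 0 < C ∧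
      ∀ (r L m : ℕ) (a : Fin d → ℤ), 2 ≤ r → 2 ≤ L → 1 ≤ m →
        FixedVolume.IsExact m a L →
        ∀ v : ℝ, 0 < v → v ≤ 1 → c / (L : ℝ) ≤ v →
          FixedVolume.periodicDiscrepancy r ⊤ (FixedVolume.korobov m a) v ≤
            ENNReal.ofReal (C * ((L : ℝ) ^ r)⁻¹ * Real.log ((L : ℝ) * v) ^ (d - 1)) := by
  obtain ⟨n, rfl⟩ := Nat.exists_eq_add_of_le' hd
  -- The constant `c = e` gives `log(Lv) ≥ 1`, so that `τ = 1/log(Lv)` is at most 1.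
  refine ⟨Real.exp 1, 40 ^ (n + 1) * Real.exp 1, by positivity, by positivity, ?_⟩
  intro r L m a hr hL hm hexact v hv _ hLv
  have hL0 : (0 : ℝ) < L := by exact_mod_cast (by omega : 0 < L)
  have hlog : 1 ≤ Real.log (L * v) := by
    rw [Real.le_log_iff_exp_le (by positivity), mul_comm]
    exact (div_le_iff₀ hL0).1 hLv
  unfold FixedVolume.periodicDiscrepancy
  refine iSup_le fun c => iSup_le fun u => iSup_le fun hu => iSup_le fun hB => iSup_le fun hvol => ?_
  have hprod := FixedVolume.prod_box_side hu hv.le hvol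
  have hr1 : (1 : ℝ) ≤ r := by exact_mod_cast (by omega : 1 ≤ r)
  rw [MeasureTheory.eLpNorm_exponent_top]
  refine MeasureTheory.eLpNormEssSup_le_of_ae_bound (Filter.Eventually.of_forall fun z => ?_)
  -- Enlarging `u_j` to the side length `r u_j` makes the product exactly `v`, with no dependence on
  -- `r`.
  have h := FixedVolume.norm_shifted_error_le (w := fun j => r * u j) hr (by omega : 1 ≤ L) hm hexact
    c hu (fun j => le_mul_of_one_le_left (hu j).le hr1)
    (FixedVolume.box_side_le_one (by omega) hu hB) (by rw [hprod]; exact hlog) z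
  rwa [hprod] at h
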